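/- Let $C\in\mathbb{R}^{n\times n}$ be symmetric positive definite with smallest eigenvalue $\lambda_{\min}(C)$, and let $s$ be an integer with $1\le s\le n$. For each $t\in[0,\lambda_{\min}(C)]$ let $A(t)\in\mathbb{R}^{n\times n}$ be any matrix with $C-tI=A(t)^{\top}A(t)$ (for instance a Cholesky factor), with columns $a_1(t),\dots,a_n(t)$, and for $x\in[0,1]^n$ put $\mathcal{M}_t(x)=\sum_{i=1}^n x_i\,a_i(t)a_i(t)^{\top}$. For a symmetric matrix $X$ let $\lambda(X)$ be the vector of its eigenvalues in nonincreasing order, let $\mathbb{I}_s\in\mathbb{R}^n$ be the vector whose first $s$ entries are $1$ and whose other entries are $0$, and for positive semidefinite $X$ put $\Phi_s(X;t)=\sum_{i=1}^s\log(\lambda_i(X)+t)$, with $\log 0=-\infty$. Let $\widehat{\Phi}_s(\cdot\,;t)$ be the concave envelope of $\Phi_s(\cdot\,;t)$ on the cone of positive semidefinite $n\times n$ matrices, i.e. the pointwise infimum of all concave functions that lie above it. Call $x\in[0,1]^n$ feasible if $\sum_{i=1}^n x_i=s$. The augmented factorization bound is $$\hat z(t)=\max\Big\{\widehat{\Phi}_s(\mathcal{M}_t(x);t):\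 x\in[0,1]^n,\ \sum_{i=1}^n x_i=s\Big\}.$$ For $y\in\mathbb{R}^n_+$ with decreasing rearrangement $y^{\downarrow}_1\ge\dots\ge y^{\downarrow}_n$, let $k\in\{0,\dots,s-1\}$ be the unique integer with $y^{\downarrow}_k>\frac{1}{s-k}\sum_{i=k+1}^n y^{\downarrow}_i\ge y^{\downarrow}_{k+1}$ (where $y^{\downarrow}_0=\infty$) and put $$\psi_s(y)=\sum_{i=1}^k\log y^{\downarrow}_i+(s-k)\log\Big(\frac{1}{s-k}\sum_{i=k+1}^n y^{\downarrow}_i\Big).$$ A vector $\mu\in\mathbb{R}^n$ majorizes $\nu\in\mathbb{R}^n$, written $\mu\succ\nu$, if $\sum_{i=1}^{\ell}\mu^{\downarrow}_i\ge\sum_{i=1}^{\ell}\nu^{\downarrow}_i$ for $1\le\ell\le n-1$ and $\sum_{i=1}^n\mu_i=\sum_{i=1}^n\nu_i$. Then: 1. For every $t\in[0,\lambda_{\min}(C)]$ the maximum defining $\hat z(t)$ is attained and finite, and $\hat z$ is nonincreasing on $[0,\lambda_{\min}(C)]$: if $0\le t_1\le t_2\le\lambda_{\min}(C)$, then $\hat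 z(t_1)\ge\hat z(t_2)$. 2. If $0\le t_1\le t_2\le\lambda_{\min}(C)$, then for every feasible $x$ $$\lambda(\mathcal{M}_{t_2}(x))+t_2\mathbb{I}_s\ \succ\ \lambda(\mathcal{M}_{t_1}(x))+t_1\mathbb{I}_s .$$ 3. $\psi_s$ is Schur-concave on $\mathbb{R}^n_+$, that is, $\psi_s(\mu)\le\psi_s(\nu)$ for all $\mu,\nu\in\mathbb{R}^n_+$ with $\mu\succ\nu$. For every $t\in[0,\lambda_{\min}(C)]$ and every feasible $x$ the objective is $\widehat{\Phi}_s(\mathcal{M}_t(x);t)=\psi_s\big(\lambda(\mathcal{M}_t(x))+t\mathbb{I}_s\big)$. If $0\le t_1\le t_2\le\lambda_{\min}(C)$, then for every feasible $x$ $$\widehat{\Phi}_s(\mathcal{M}_{t_2}(x);t_2)\le\widehat{\Phi}_s(\mathcal{M}_{t_1}(x);t_1).$$ -/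

import Mathlib

open Matrix Set

/-! ### Vectors: nonincreasing rearrangement, majorization, Schur-concavity -/

/-- The nonincreasing rearrangement of `y`; the entry with (zero-based) index `i` is the
`(i+1)`-st largest entry of `y`. -/
noncomputable def sortDesc {n : ℕ} (y : Fin n → ℝ) : Fin n → ℝ :=
  y ∘ Tuple.sort (fun i => -y i)

/-- `Majorizes μ ν` : the vector `μ` majorizes the vector `ν`. -/
def Majorizes {n : ℕ} (μ ν : Fin n → ℝ) : Prop :=
  (∀ ℓ : ℕ, 1 ≤ ℓ → ℓ < n →
    ∑ i with (i : Fin n).val < ℓ, sortDesc ν i ≤ ∑ i with (i : Fin n).val < ℓ, sortDesc μ i) ∧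
  ∑ i, μ i = ∑ i, ν i

/-- Schur-concavity of an extended-real-valued function on a set `D` of vectors. -/
def SchurConcaveOn {n : ℕ} (D : Set (Fin n → ℝ)) (f : (Fin n → ℝ) → EReal) : Prop :=
  ∀ ν ∈ D, ∀ μ ∈ D, Majorizes μ ν → f μ ≤ f ν

/-- Natural logarithm of a nonnegative real number, with `log 0 = -∞`. -/
noncomputable def elog (r : ℝ) : EReal := ENNReal.log (ENNReal.ofReal r)

/-! ### The function `ψ_s` -/

/-- The sum of all entries of `y` except the `k` largest ones. -/
noncomputable def tailSum {n : ℕ} (y : Fin n → ℝ) (k : ℕ) : ℝ :=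
  ∑ i with k ≤ (i : Fin n).val, sortDesc y i

/-- `k` satisfies `0 ≤ k ≤ s - 1` and
`y↓_k > (y↓_{k+1} + ⋯ + y↓_n) / (s - k) ≥ y↓_{k+1}` (one-based indices), where `y↓_0 = ∞`. -/
def IsPsiIndex {n : ℕ} (s : ℕ) (y : Fin n → ℝ) (k : ℕ) : Prop :=
  k < s ∧
  (∀ j : Fin n, j.val + 1 = k → tailSum y k / ((s : ℝ) - k) < sortDesc y j) ∧
  (∀ j : Fin n, j.val = k → sortDesc y j ≤ tailSum y k / ((s : ℝ) - k))

/-- The index `k` in the definition of `ψ_s`. -/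
noncomputable def psiIndex {n : ℕ} (s : ℕ) (y : Fin n → ℝ) : ℕ :=
  sInf {k | IsPsiIndex s y k}

/-- `ψ_s(y) = ∑_{i ≤ k} log y↓_i + (s - k) log ((∑_{i > k} y↓_i) / (s - k))`. -/
noncomputable def psi {n : ℕ} (s : ℕ) (y : Fin n → ℝ) : EReal :=
  (∑ i with (i : Fin n).val < psiIndex s y, elog (sortDesc y i)) +
    (s - psiIndex s y) • elog (tailSum y (psiIndex s y) / ((s : ℝ) - psiIndex s y))

/-! ### Eigenvalues -/

open Classical in
/-- The eigenvalues of a symmetric matrix with multiplicity, in nonincreasing order. -/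
noncomputable def eigVec {n : ℕ} (X : Matrix (Fin n) (Fin n) ℝ) : Fin n → ℝ :=
  if h : X.IsHermitian then fun i => h.eigenvalues₀ (Fin.cast (Fintype.card_fin n).symm i)
  else 0

/-- The smallest eigenvalue of a symmetric matrix. -/
noncomputable def lamMin {n : ℕ} (X : Matrix (Fin n) (Fin n) ℝ) : ℝ := ⨅ i, eigVec X i

/-- The vector `λ(X) + t 𝕀_s`, where the first `s` entries of `𝕀_s` are `1` and the rest `0`. -/
noncomputable def pertEig {n : ℕ} (s : ℕ) (t : ℝ) (X : Matrix (Fin n) (Fin n) ℝ) : Fin n → ℝ :=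
  fun i => eigVec X i + t * (if i.val < s then 1 else 0)

/-! ### The function `Φ_s` and its concave envelope -/

/-- `Φ_s(X; t)`, the sum of `log (λ_i(X) + t)` over the `s` largest eigenvalues. -/
noncomputable def Phi {n : ℕ} (s : ℕ) (t : ℝ) (X : Matrix (Fin n) (Fin n) ℝ) : EReal :=
  ∑ i with (i : Fin n).val < s, elog (eigVec X i + t)

/-- An extended-real-valued function is concave on `D` if its hypograph over `D` is convex. -/
def EConcaveOn {E : Type*} [AddCommGroup E] [Module ℝ E] (D : Set E) (g : E → EReal) : Prop :=
  Convex ℝ {p : E × ℝ | p.1 ∈ D ∧ (p.2 : EReal) ≤ g p.1}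

/-- The concave envelope of `f` on `D`: the pointwise infimum of all concave functions on `D`
that are at least `f` on `D`. -/
noncomputable def concaveEnvelope {E : Type*} [AddCommGroup E] [Module ℝ E] (D : Set E)
    (f : E → EReal) (x : E) : EReal :=
  sInf {r | ∃ g : E → EReal, EConcaveOn D g ∧ (∀ y ∈ D, f y ≤ g y) ∧ r = g x}

/-- The concave envelope of `Φ_s(·; t)` on the cone of positive semidefinite matrices. -/
noncomputable def PhiHat {n : ℕ} (s : ℕ) (t : ℝ) (X : Matrix (Fin n) (Fin n) ℝ) : EReal :=
  concaveEnvelope {Y : Matrix (Fin n) (Fin n) ℝ | Y.PosSemidef} (Phi s t) X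

/-! ### The augmented factorization bound -/

/-- `∑ i, x_i a_i a_iᵀ`, where `a_i` is the `i`-th column of `A`. -/
def weightedGram {n : ℕ} (A : Matrix (Fin n) (Fin n) ℝ) (x : Fin n → ℝ) :
    Matrix (Fin n) (Fin n) ℝ :=
  ∑ i, x i • vecMulVec (A.col i) (A.col i)

/-- The vectors `x ∈ [0,1]^n` with `∑ i, x_i = s`. -/
def feasible (n s : ℕ) : Set (Fin n → ℝ) :=
  {x | (∀ i, 0 ≤ x i ∧ x i ≤ 1) ∧ ∑ i, x i = s}

/-- The objective of the relaxation at `x`, for a factor `A` of `C - t I`. -/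
noncomputable def objective {n : ℕ} (s : ℕ) (t : ℝ) (A : Matrix (Fin n) (Fin n) ℝ)
    (x : Fin n → ℝ) : EReal :=
  PhiHat s t (weightedGram A x)

/-- The augmented factorization bound `ẑ(t)`, for a factor `A` of `C - t I`. -/
noncomputable def zHat {n : ℕ} (s : ℕ) (t : ℝ) (A : Matrix (Fin n) (Fin n) ℝ) : EReal :=
  sSup (objective s t A '' feasible n s)

/-! ### Sums over initial segments of `Fin n` -/

/-! Everything rests on a dual formula: `psi s y` is the infimum, over positive nondecreasing
weights `w`, of `∑ w_i y↓_i - s - ∑_{i<s} log w_i` (`psi_le_dualValue`, `exists_dualValue_lt`). A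
nondecreasing weight paired with a vector reverses the order of partial sums, so Schur-concavity is
immediate.

By Ky Fan's principle, replacing the eigenvalues of `X` by the diagonal of `Vᵀ X V` can only raise
each dual value. Hence `X ↦ psi s (pertEig s t X)` is an infimum of continuous affine functions:
concave and upper semicontinuous. It lies above `Phi`. It is the least such concave function because
`X` is a convex combination, within one eigenbasis, of matrices at which `Phi` is already at least
this value (`psi_pertEig_le_of_eConcaveOn`, through the vertices of a hypersimplex). So it is the
envelope.

For the majorization, put `E = diag(√x)`. The spectrum of the Gram matrix is that of `E (C - tI) E`,
and lowering `t` from `t₂` to `t₁` adds `(t₂ - t₁) diag x`. As `0 ≤ diag x ≤ I` has trace `s`, this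
adds at most `(t₂ - t₁) min(ℓ, s)` to the sum of the top `ℓ` eigenvalues, exactly what the shift by
`𝕀_s` compensates. Schur-concavity then gives monotonicity at each feasible point, hence of the
bound. -/

theorem sum_mul_le_mul_sum_of_prefix_nonneg {n : ℕ} {w d : Fin n → ℝ} (hw : Monotone w)
    (hd : ∀ ℓ : ℕ, 0 ≤ ∑ i with (i : Fin n).val < ℓ, d i) {M : ℝ} (hM : ∀ i, w i ≤ M) :
    ∑ i, w i * d i ≤ M * ∑ i, d i := by
  induction n generalizing M with
  | zero => simp
  | succ n ih =>
    have h1 : ∀ ℓ : ℕ, 0 ≤ ∑ i with (i : Fin n).val < ℓ, d i.castSucc := by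
      intro ℓ
      have := hd (min ℓ n)
      rw [Finset.sum_filter, Fin.sum_univ_castSucc] at this
      simpa [Finset.sum_filter] using this
    have h2 := ih (w := fun i => w i.castSucc) (d := fun i => d i.castSucc)
      (fun i j hij => hw (by simpa using hij)) h1 (M := w (Fin.last n))
      (fun i => hw (Fin.le_last _))
    have h3 : 0 ≤ ∑ i, d i :=
      (hd (n + 1)).trans_eq (by rw [Finset.filter_true_of_mem fun i _ => i.is_lt])
    calc ∑ i, w i * d i ≤ w (Fin.last n) * ∑ i, d i := by
          rw [Fin.sum_univ_castSucc, Fin.sum_univ_castSucc, mul_add]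
          gcongr
      _ ≤ M * ∑ i, d i := mul_le_mul_of_nonneg_right (hM _) h3

/-- Pairing with a nondecreasing weight reverses the dominance order of partial sums. -/
theorem sum_mul_le_sum_mul_of_prefix_le {n : ℕ} {w a b : Fin n → ℝ} (hw : Monotone w)
    (h : ∀ ℓ : ℕ, ∑ i with (i : Fin n).val < ℓ, a i ≤ ∑ i with (i : Fin n).val < ℓ, b i)
    (htot : ∑ i, a i = ∑ i, b i) :
    ∑ i, w i * b i ≤ ∑ i, w i * a i := by
  -- The differences sum to zero, so any upper bound for the weights will do.
  have key := sum_mul_le_mul_sum_of_prefix_nonneg (d := fun i => b i - a i) hw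
    (fun ℓ => by rw [Finset.sum_sub_distrib]; linarith [h ℓ]) (M := ∑ j, |w j|)
    (fun i => (le_abs_self _).trans
      (Finset.single_le_sum (f := fun j => |w j|) (fun j _ => abs_nonneg _) (Finset.mem_univ i)))
  simp only [mul_sub, Finset.sum_sub_distrib, htot, sub_self] at key
  linarith

/-- Turns the two-piece formula of `psi` into one sum over the first `s` coordinates of a flattened
vector. -/
theorem sum_prefix_ite {n k s : ℕ} {M : Type*} [AddCommMonoid M] (hks : k ≤ s) (hsn : s ≤ n)
    (g : Fin n → M) (C : M) :
    ∑ i with (i : Fin n).val < s, (if i.val < k then g i else C) =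
      (∑ i with (i : Fin n).val < k, g i) + (s - k) • C := by
  rw [Finset.sum_ite, Finset.filter_filter, Finset.filter_filter, Finset.sum_const]
  congr 2
  · congr 1; ext i; simp; omega
  · have : (Finset.univ.filter fun i : Fin n => i.val < s ∧ ¬ i.val < k) =
        (Finset.univ.filter fun i : Fin n => i.val < s) \
          (Finset.univ.filter fun i : Fin n => i.val < k) := by
      ext i; simp
    rw [this, Finset.card_sdiff_of_subset (by intro i; simp; omega), Fin.card_filter_val_lt,
      Fin.card_filter_val_lt]
    omega

theorem sum_prefix_add_sum_suffix {n : ℕ} (k : ℕ) (f : Fin n → ℝ) :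
    (∑ i with (i : Fin n).val < k, f i) + ∑ i with k ≤ (i : Fin n).val, f i = ∑ i, f i := by
  rw [← Finset.sum_filter_add_sum_filter_not Finset.univ (fun i : Fin n => i.val < k)]
  simp

/-! ### Nonincreasing rearrangement -/

theorem sortDesc_antitone {n : ℕ} (y : Fin n → ℝ) : Antitone (sortDesc y) := by
  intro i j hij
  have := Tuple.monotone_sort (fun i => -y i) hij
  simpa [sortDesc] using this

theorem sortDesc_eq_self {n : ℕ} {y : Fin n → ℝ} (hy : Antitone y) : sortDesc y = y := by
  have : Tuple.sort (fun i => -y i) = Equiv.refl _ :=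
    Tuple.sort_eq_refl_iff_monotone.2 fun i j hij => neg_le_neg (hy hij)
  simp [sortDesc, this]

theorem sum_sortDesc {n : ℕ} (y : Fin n → ℝ) : ∑ i, sortDesc y i = ∑ i, y i :=
  Equiv.sum_comp (Tuple.sort fun i => -y i) y

theorem sortDesc_nonneg {n : ℕ} {y : Fin n → ℝ} (hy : ∀ i, 0 ≤ y i) (i : Fin n) :
    0 ≤ sortDesc y i := hy _

theorem Majorizes.prefix_le {n : ℕ} {μ ν : Fin n → ℝ} (h : Majorizes μ ν) (ℓ : ℕ) :
    ∑ i with (i : Fin n).val < ℓ, sortDesc ν i ≤ ∑ i with (i : Fin n).val < ℓ, sortDesc μ i := by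
  rcases Nat.eq_zero_or_pos ℓ with rfl | h0
  · simp
  rcases lt_or_ge ℓ n with h1 | h1
  · exact h.1 ℓ h0 h1
  · have : (Finset.univ.filter fun i : Fin n => i.val < ℓ) = Finset.univ := by
      ext i; simp; omega
    rw [this, sum_sortDesc, sum_sortDesc, h.2]

/-! ### The logarithm -/

theorem elog_of_pos {r : ℝ} (hr : 0 < r) : elog r = (Real.log r : EReal) :=
  ENNReal.log_ofReal_of_pos hr

theorem elog_zero : elog 0 = ⊥ := by simp [elog]

theorem elog_mono : Monotone elog := fun _ _ h =>
  ENNReal.log_monotone (ENNReal.ofReal_le_ofReal h)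

theorem EReal.coe_finset_sum {ι : Type*} (S : Finset ι) (f : ι → ℝ) :
    ((∑ i ∈ S, f i : ℝ) : EReal) = ∑ i ∈ S, (f i : EReal) := by
  classical
  induction S using Finset.induction_on with
  | empty => simp
  | insert a S ha ih => rw [Finset.sum_insert ha, Finset.sum_insert ha, EReal.coe_add, ih]

theorem sum_elog_of_pos {ι : Type*} {S : Finset ι} {f : ι → ℝ} (h : ∀ i ∈ S, 0 < f i) :
    ∑ i ∈ S, elog (f i) = ((∑ i ∈ S, Real.log (f i) : ℝ) : EReal) := by
  rw [EReal.coe_finset_sum]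
  exact Finset.sum_congr rfl fun i hi => elog_of_pos (h i hi)

/-! ### The index in the definition of `psi` -/

theorem tailSum_eq {n : ℕ} (y : Fin n → ℝ) {k : ℕ} (hk : k < n) :
    tailSum y k = sortDesc y ⟨k, hk⟩ + tailSum y (k + 1) := by
  unfold tailSum
  have : (Finset.univ.filter fun i : Fin n => k ≤ i.val) =
      insert ⟨k, hk⟩ (Finset.univ.filter fun i : Fin n => k + 1 ≤ i.val) := by
    ext i; simp [Fin.ext_iff]; omega
  rw [this, Finset.sum_insert (by simp)]

theorem tailSum_nonneg {n : ℕ} {y : Fin n → ℝ} (hy : ∀ i, 0 ≤ y i) (k : ℕ) : 0 ≤ tailSum y k :=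
  Finset.sum_nonneg fun i _ => sortDesc_nonneg hy i

/-- The least `k` satisfying the second inequality works; `s - 1` is a candidate, since a tail sum
dominates its first term. Failure at `k - 1` rearranges to the strict inequality at `k`. -/
theorem exists_isPsiIndex {n s : ℕ} (hs : 1 ≤ s) (hsn : s ≤ n) {y : Fin n → ℝ}
    (hy : ∀ i, 0 ≤ y i) : ∃ k, IsPsiIndex s y k := by
  classical
  have hex : ∃ k, ∃ h : k < s,
      sortDesc y ⟨k, h.trans_le hsn⟩ ≤ tailSum y k / ((s : ℝ) - k) := by
    refine ⟨s - 1, by omega, ?_⟩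
    have h1 : ((s : ℝ) - (s - 1 : ℕ)) = 1 := by
      rw [Nat.cast_sub hs]; simp
    rw [h1, div_one, tailSum_eq y (by omega : s - 1 < n)]
    linarith [tailSum_nonneg hy (s - 1 + 1)]
  obtain ⟨hk, hle⟩ := Nat.find_spec hex
  refine ⟨Nat.find hex, hk, ?_, ?_⟩
  · intro j hj
    have hmin := Nat.find_min hex (m := j.val) (by omega)
    push Not at hmin
    have h1 := hmin (by omega)
    have hj1 : (Nat.find hex : ℝ) = j.val + 1 := by rw [← hj]; push_cast; ring
    have hjs : (j.val : ℝ) + 1 + 1 ≤ s := by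
      have : j.val + 1 + 1 ≤ s := by omega
      exact_mod_cast this
    rw [tailSum_eq y j.is_lt, div_lt_iff₀ (by linarith)] at h1
    rw [hj1, ← hj, div_lt_iff₀ (by linarith)]
    simp only [Fin.eta] at h1
    nlinarith
  · intro j hj
    have : j = ⟨Nat.find hex, hk.trans_le hsn⟩ := Fin.ext hj
    rw [this]; exact hle

theorem isPsiIndex_psiIndex {n s : ℕ} (hs : 1 ≤ s) (hsn : s ≤ n) {y : Fin n → ℝ}
    (hy : ∀ i, 0 ≤ y i) : IsPsiIndex s y (psiIndex s y) :=
  Nat.sInf_mem (exists_isPsiIndex hs hsn hy)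

/-- The average `(y↓_{k+1} + ⋯ + y↓_n) / (s - k)` at the index `k` of `ψ_s`. -/
noncomputable def psiMean {n : ℕ} (s : ℕ) (y : Fin n → ℝ) : ℝ :=
  tailSum y (psiIndex s y) / ((s : ℝ) - psiIndex s y)

section psi

variable {n s : ℕ} {y : Fin n → ℝ}

theorem psiIndex_lt (hs : 1 ≤ s) (hsn : s ≤ n) (hy : ∀ i, 0 ≤ y i) : psiIndex s y < s :=
  (isPsiIndex_psiIndex hs hsn hy).1

theorem sub_psiIndex_pos (hs : 1 ≤ s) (hsn : s ≤ n) (hy : ∀ i, 0 ≤ y i) :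
    0 < (s : ℝ) - psiIndex s y := by
  have : (psiIndex s y : ℝ) < s := by exact_mod_cast psiIndex_lt hs hsn hy
  linarith

theorem psiMean_nonneg (hs : 1 ≤ s) (hsn : s ≤ n) (hy : ∀ i, 0 ≤ y i) : 0 ≤ psiMean s y :=
  div_nonneg (tailSum_nonneg hy _) (sub_psiIndex_pos hs hsn hy).le

theorem sub_mul_psiMean (hs : 1 ≤ s) (hsn : s ≤ n) (hy : ∀ i, 0 ≤ y i) :
    ((s : ℝ) - psiIndex s y) * psiMean s y = tailSum y (psiIndex s y) :=
  mul_div_cancel₀ _ (sub_psiIndex_pos hs hsn hy).ne'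

theorem psiMean_lt_sortDesc (hs : 1 ≤ s) (hsn : s ≤ n) (hy : ∀ i, 0 ≤ y i) {i : Fin n}
    (hi : i.val < psiIndex s y) : psiMean s y < sortDesc y i := by
  have h := isPsiIndex_psiIndex hs hsn hy
  have hk := h.1
  exact (h.2.1 ⟨psiIndex s y - 1, by omega⟩ (by simp; omega)).trans_le
    (sortDesc_antitone y (Fin.le_def.2 (by simp; omega)))

theorem sortDesc_le_psiMean (hs : 1 ≤ s) (hsn : s ≤ n) (hy : ∀ i, 0 ≤ y i) {i : Fin n}
    (hi : psiIndex s y ≤ i.val) : sortDesc y i ≤ psiMean s y := by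
  have h := isPsiIndex_psiIndex hs hsn hy
  have hk := h.1
  exact (sortDesc_antitone y (Fin.le_def.2 (by simpa using hi))).trans
    (h.2.2 ⟨psiIndex s y, by omega⟩ rfl)

theorem sortDesc_pos_of_lt_psiIndex (hs : 1 ≤ s) (hsn : s ≤ n) (hy : ∀ i, 0 ≤ y i) {i : Fin n}
    (hi : i.val < psiIndex s y) : 0 < sortDesc y i :=
  (psiMean_nonneg hs hsn hy).trans_lt (psiMean_lt_sortDesc hs hsn hy hi)

theorem psi_eq_bot (hs : 1 ≤ s) (hsn : s ≤ n) (hy : ∀ i, 0 ≤ y i) (h0 : psiMean s y = 0) :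
    psi s y = ⊥ := by
  have hk := psiIndex_lt hs hsn hy
  unfold psi
  rw [← psiMean, h0, elog_zero]
  obtain ⟨m, hm⟩ : ∃ m, s - psiIndex s y = m + 1 := ⟨s - psiIndex s y - 1, by omega⟩
  rw [hm, succ_nsmul, EReal.add_bot, EReal.add_bot]

theorem psi_eq_coe (hs : 1 ≤ s) (hsn : s ≤ n) (hy : ∀ i, 0 ≤ y i) (h0 : 0 < psiMean s y) :
    psi s y = ((∑ i with (i : Fin n).val < psiIndex s y, Real.log (sortDesc y i) +
      (s - psiIndex s y : ℕ) • Real.log (psiMean s y) : ℝ) : EReal) := by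
  unfold psi
  rw [← psiMean, elog_of_pos h0, sum_elog_of_pos, EReal.coe_add, EReal.coe_nsmul]
  intro i hi
  exact sortDesc_pos_of_lt_psiIndex hs hsn hy (by simpa using hi)

/-! ### `psi` as an infimum of linear functions of the sorted vector -/

/-- The value at `z` of the affine majorant of `ψ_s` with slope `w`. -/
noncomputable def dualValue {n : ℕ} (s : ℕ) (w z : Fin n → ℝ) : ℝ :=
  ∑ i, w i * z i - s - ∑ i with (i : Fin n).val < s, Real.log (w i)

/-- Flatten the tail of `y↓` to its mean on the coordinates from `k` to `s - 1`, giving `v`. Apply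
`log (w_i v_i) ≤ w_i v_i - 1` termwise; flattening moves mass towards smaller weights, so `∑ w v ≤ ∑
w y↓`. -/
theorem psi_le_dualValue (hs : 1 ≤ s) (hsn : s ≤ n) (hy : ∀ i, 0 ≤ y i) {w : Fin n → ℝ}
    (hw0 : ∀ i, 0 < w i) (hw : Monotone w) : psi s y ≤ (dualValue s w (sortDesc y) : EReal) := by
  rcases (psiMean_nonneg hs hsn hy).eq_or_lt with h0 | h0
  · rw [psi_eq_bot hs hsn hy h0.symm]; exact bot_le
  rw [psi_eq_coe hs hsn hy h0, EReal.coe_le_coe_iff, dualValue]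
  have hk := psiIndex_lt hs hsn hy
  have hmean := sub_mul_psiMean hs hsn hy
  set k := psiIndex s y with hkdef
  set c := psiMean s y with hcdef
  set z := sortDesc y with hzdef
  set v : Fin n → ℝ := fun i => if i.val < k then z i else c with hv
  have hvpos : ∀ i, 0 < v i := fun i => by
    simp only [hv]; split_ifs with h
    · exact sortDesc_pos_of_lt_psiIndex hs hsn hy h
    · exact h0
  have hzv : ∀ i, z i ≤ v i := fun i => by
    simp only [hv]; split_ifs with h
    · exact le_rfl
    · exact sortDesc_le_psiMean hs hsn hy (not_lt.1 h)
  have e1 : ∑ i with (i : Fin n).val < k, Real.log (z i) + (s - k : ℕ) • Real.log c =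
      ∑ i with (i : Fin n).val < s, Real.log (v i) := by
    rw [← sum_prefix_ite hk.le hsn]
    refine Finset.sum_congr rfl fun i _ => ?_
    simp only [hv]; split_ifs <;> rfl
  have e2 : ∑ i with (i : Fin n).val < s, v i = ∑ i, z i := by
    simp only [hv]
    rw [sum_prefix_ite hk.le hsn, ← sum_prefix_add_sum_suffix k z, nsmul_eq_mul,
      Nat.cast_sub hk.le, hmean]
    rfl
  have e3 : ∑ i with (i : Fin n).val < s, w i * v i ≤ ∑ i, w i * z i := by
    -- Threshold weight: before `s`, `v` exceeds `z` and `w ≤ W`; from `s` on, mass is only removed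
    -- and `w ≥ W`. The net mass is zero.
    set W := w ⟨s - 1, by omega⟩ with hW
    have : ∀ i : Fin n, w i * (if i.val < s then v i else 0) - w i * z i ≤
        W * ((if i.val < s then v i else 0) - z i) := by
      intro i
      rw [← mul_sub]
      split_ifs with h
      · exact mul_le_mul_of_nonneg_right (hw (Fin.le_def.2 (by simp; omega)))
          (sub_nonneg.2 (hzv i))
      · have h1 : W ≤ w i := hw (Fin.le_def.2 (by simp; omega))
        have h2 : 0 ≤ z i := sortDesc_nonneg hy i
        nlinarith
    have h4 := Finset.sum_le_sum fun i (_ : i ∈ Finset.univ) => this i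
    rw [← Finset.mul_sum, Finset.sum_sub_distrib, Finset.sum_sub_distrib, ← Finset.sum_filter,
      e2, sub_self, mul_zero] at h4
    simp only [mul_ite, mul_zero, ← Finset.sum_filter] at h4
    linarith
  have e4 : ∑ i with (i : Fin n).val < s, (Real.log (v i) + Real.log (w i)) ≤
      ∑ i with (i : Fin n).val < s, (w i * v i - 1) := by
    refine Finset.sum_le_sum fun i _ => ?_
    rw [add_comm, ← Real.log_mul (hw0 i).ne' (hvpos i).ne']
    exact Real.log_le_sub_one_of_pos (mul_pos (hw0 i) (hvpos i))
  rw [Finset.sum_add_distrib, Finset.sum_sub_distrib, Finset.sum_const, Fin.card_filter_val_lt,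
    min_eq_right hsn, nsmul_eq_mul, mul_one] at e4
  rw [e1]
  linarith

theorem dualValue_ite (hs : 1 ≤ s) (hsn : s ≤ n) (hy : ∀ i, 0 ≤ y i) (m : ℝ) :
    dualValue s (fun i => if i.val < psiIndex s y then (sortDesc y i)⁻¹ else m) (sortDesc y) =
      psiIndex s y + m * tailSum y (psiIndex s y) - s +
        ∑ i with (i : Fin n).val < psiIndex s y, Real.log (sortDesc y i) -
        ((s : ℝ) - psiIndex s y) * Real.log m := by
  have hk := psiIndex_lt hs hsn hy
  unfold dualValue
  have e1 : ∑ i with (i : Fin n).val < s,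
      Real.log (if i.val < psiIndex s y then (sortDesc y i)⁻¹ else m) =
      -∑ i with (i : Fin n).val < psiIndex s y, Real.log (sortDesc y i) +
        ((s : ℝ) - psiIndex s y) * Real.log m := by
    rw [← Nat.cast_sub hk.le, ← nsmul_eq_mul, ← Finset.sum_neg_distrib,
      ← sum_prefix_ite hk.le hsn]
    refine Finset.sum_congr rfl fun i _ => ?_
    split_ifs
    · rw [Real.log_inv]
    · rfl
  have e2 : ∑ i, (if i.val < psiIndex s y then (sortDesc y i)⁻¹ else m) * sortDesc y i =
      psiIndex s y + m * tailSum y (psiIndex s y) := by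
    rw [← sum_prefix_add_sum_suffix (psiIndex s y), tailSum, Finset.mul_sum]
    congr 1
    · rw [Finset.sum_congr rfl (g := fun _ => (1 : ℝ))]
      · simp [Fin.card_filter_val_lt]; omega
      · intro i hi
        have hi' : i.val < psiIndex s y := by simpa using hi
        rw [if_pos hi', inv_mul_cancel₀ (sortDesc_pos_of_lt_psiIndex hs hsn hy hi').ne']
    · refine Finset.sum_congr rfl fun i hi => ?_
      rw [if_neg (by simpa using hi)]
  rw [e1, e2]; ring

/-- The optimal weight is the inverse of the flattened vector. If the tail mean is `0` there is no
minimizer, but the dual value tends to `-∞` as the tail weight `m` grows; hence the formulation with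
a strict bound `r`. -/
theorem exists_dualValue_lt (hs : 1 ≤ s) (hsn : s ≤ n) (hy : ∀ i, 0 ≤ y i) {r : ℝ}
    (hr : psi s y < r) : ∃ w : Fin n → ℝ, (∀ i, 0 < w i) ∧ Monotone w ∧
      dualValue s w (sortDesc y) < r := by
  have hk := psiIndex_lt hs hsn hy
  have main : ∀ m : ℝ, 0 < m → (∀ i : Fin n, i.val < psiIndex s y → (sortDesc y i)⁻¹ ≤ m) →
      psiIndex s y + m * tailSum y (psiIndex s y) - s +
        ∑ i with (i : Fin n).val < psiIndex s y, Real.log (sortDesc y i) -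
        ((s : ℝ) - psiIndex s y) * Real.log m < r →
      ∃ w : Fin n → ℝ, (∀ i, 0 < w i) ∧ Monotone w ∧ dualValue s w (sortDesc y) < r := by
    intro m hm hle hlt
    refine ⟨fun i => if i.val < psiIndex s y then (sortDesc y i)⁻¹ else m, ?_, ?_, ?_⟩
    · intro i
      dsimp only
      split_ifs with h
      · exact inv_pos.2 (sortDesc_pos_of_lt_psiIndex hs hsn hy h)
      · exact hm
    · intro i j hij
      have hij' : i.val ≤ j.val := hij
      dsimp only
      split_ifs with h1 h2 h2
      · exact inv_anti₀ (sortDesc_pos_of_lt_psiIndex hs hsn hy h2) (sortDesc_antitone y hij)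
      · exact hle i h1
      · omega
      · exact le_rfl
    · rw [dualValue_ite hs hsn hy]; exact hlt
  have hmean := sub_mul_psiMean hs hsn hy
  rcases (psiMean_nonneg hs hsn hy).eq_or_lt with h0 | h0
  · rw [← h0, mul_zero] at hmean
    simp only [← hmean, mul_zero, add_zero] at main
    set K := (psiIndex s y : ℝ) - s +
      ∑ i with (i : Fin n).val < psiIndex s y, Real.log (sortDesc y i) with hK
    -- Since `s - k ≥ 1`, a positive `log m > K - r` forces `K - (s - k) log m < r`.
    have hev : ∀ᶠ m : ℝ in Filter.atTop, 0 < m ∧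
        (∀ i : Fin n, (sortDesc y i)⁻¹ ≤ m) ∧ max 0 (K - r) < Real.log m :=
      (Filter.eventually_gt_atTop 0).and ((Filter.eventually_all.2 fun i =>
        Filter.eventually_ge_atTop _).and (Real.tendsto_log_atTop.eventually_gt_atTop _))
    obtain ⟨m, hm, hle, hlog⟩ := hev.exists
    refine main m hm (fun i _ => hle i) ?_
    have h1 : (1 : ℝ) ≤ (s : ℝ) - psiIndex s y := by
      have : (psiIndex s y : ℝ) + 1 ≤ s := by exact_mod_cast hk
      linarith
    have h2 := (max_lt_iff.1 hlog).1
    have h3 := (max_lt_iff.1 hlog).2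
    nlinarith
  · refine main (psiMean s y)⁻¹ (inv_pos.2 h0) (fun i hi =>
      inv_anti₀ h0 (psiMean_lt_sortDesc hs hsn hy hi).le) ?_
    rw [psi_eq_coe hs hsn hy h0, EReal.coe_lt_coe_iff, nsmul_eq_mul, Nat.cast_sub hk.le] at hr
    have h1 : (psiMean s y)⁻¹ * tailSum y (psiIndex s y) = (s : ℝ) - psiIndex s y := by
      rw [← hmean]; field_simp
    rw [h1, Real.log_inv]
    linarith

theorem dualValue_le_of_prefix_le {w a b : Fin n → ℝ} (hw : Monotone w)
    (h : ∀ ℓ : ℕ, ∑ i with (i : Fin n).val < ℓ, a i ≤ ∑ i with (i : Fin n).val < ℓ, b i)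
    (htot : ∑ i, a i = ∑ i, b i) : dualValue s w b ≤ dualValue s w a := by
  unfold dualValue
  linarith [sum_mul_le_sum_mul_of_prefix_le hw h htot]

/-- A nearly optimal weight for `ν` is admissible for `μ` and has a smaller dual value there. -/
theorem psi_schurConcaveOn (hs : 1 ≤ s) (hsn : s ≤ n) :
    SchurConcaveOn {y : Fin n → ℝ | ∀ i, 0 ≤ y i} (psi s) := by
  intro ν hν μ hμ h
  by_contra hlt
  obtain ⟨r, hr1, hr2⟩ := EReal.exists_between_coe_real (not_le.1 hlt)
  obtain ⟨w, hw0, hw, hwr⟩ := exists_dualValue_lt hs hsn hν hr1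
  have h1 := psi_le_dualValue hs hsn hμ hw0 hw
  have h2 := dualValue_le_of_prefix_le (s := s) hw h.prefix_le
    (by rw [sum_sortDesc, sum_sortDesc, h.2])
  have h3 := hr2.trans_le h1
  rw [EReal.coe_lt_coe_iff] at h3
  linarith

theorem psi_ne_top (hs : 1 ≤ s) (hsn : s ≤ n) (hy : ∀ i, 0 ≤ y i) : psi s y ≠ ⊤ := by
  intro h
  have := psi_le_dualValue hs hsn hy (w := fun _ => 1) (fun _ => one_pos) monotone_const
  rw [h, top_le_iff] at this
  exact EReal.coe_ne_top _ this

theorem psi_ne_bot (hs : 1 ≤ s) (hsn : s ≤ n) (hy : ∀ i, 0 ≤ y i)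
    (hpos : ∀ i : Fin n, i.val < s → 0 < sortDesc y i) : psi s y ≠ ⊥ := by
  have hk := psiIndex_lt hs hsn hy
  have h0 : 0 < psiMean s y :=
    (hpos ⟨psiIndex s y, by omega⟩ hk).trans_le (sortDesc_le_psiMean hs hsn hy le_rfl)
  rw [psi_eq_coe hs hsn hy h0]
  exact EReal.coe_ne_bot _

end psi

/-! ### Sorted eigenvalues -/

section eig

variable {n : ℕ} {X : Matrix (Fin n) (Fin n) ℝ}

theorem eigVec_antitone (hX : X.IsHermitian) : Antitone (eigVec X) := by
  intro i j hij
  unfold eigVec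
  rw [dif_pos hX]
  exact hX.eigenvalues₀_antitone (show i.val ≤ j.val from hij)

/-- `eigenvalues` reindexes the sorted `eigenvalues₀` along an unspecified bijection, so it matches
`eigVec` only up to a permutation. -/
theorem exists_perm_eigenvalues_eq (hX : X.IsHermitian) :
    ∃ σ : Equiv.Perm (Fin n), ∀ i, hX.eigenvalues i = eigVec X (σ i) :=
  ⟨(Fintype.equivOfCardEq (Fintype.card_fin _)).symm.trans (finCongr (Fintype.card_fin n)),
    fun i => by
      unfold eigVec
      rw [dif_pos hX]
      rfl⟩

theorem eigVec_nonneg (hX : X.PosSemidef) (i : Fin n) : 0 ≤ eigVec X i := by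
  obtain ⟨σ, hσ⟩ := exists_perm_eigenvalues_eq hX.1
  rw [← σ.apply_symm_apply i, ← hσ]
  exact hX.eigenvalues_nonneg _

theorem eigVec_pos (hX : X.PosDef) (i : Fin n) : 0 < eigVec X i := by
  obtain ⟨σ, hσ⟩ := exists_perm_eigenvalues_eq hX.1
  rw [← σ.apply_symm_apply i, ← hσ]
  exact hX.eigenvalues_pos _

theorem sum_eigVec (hX : X.IsHermitian) : ∑ i, eigVec X i = X.trace := by
  obtain ⟨σ, hσ⟩ := exists_perm_eigenvalues_eq hX
  rw [hX.trace_eq_sum_eigenvalues, ← Equiv.sum_comp σ]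
  simp [hσ]

theorem charpoly_eq_prod_eigVec (hX : X.IsHermitian) :
    X.charpoly = ∏ i, (Polynomial.X - Polynomial.C (eigVec X i)) := by
  obtain ⟨σ, hσ⟩ := exists_perm_eigenvalues_eq hX
  rw [hX.charpoly_eq, ← Equiv.prod_comp σ fun i => Polynomial.X - Polynomial.C (eigVec X i)]
  simp [hσ]

/-- The roots agree as multisets, and two nonincreasing lists that are permutations of each other
coincide. -/
theorem eigVec_eq_sortDesc_of_charpoly (hX : X.IsHermitian) {q : Fin n → ℝ}
    (h : X.charpoly = ∏ i, (Polynomial.X - Polynomial.C (q i))) : eigVec X = sortDesc q := by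
  have h1 : X.charpoly = ∏ i, (Polynomial.X - Polynomial.C (sortDesc q i)) := by
    rw [h]
    exact (Equiv.prod_comp (Tuple.sort fun i => -q i)
      (fun i => Polynomial.X - Polynomial.C (q i))).symm
  have h2 := charpoly_eq_prod_eigVec hX
  have h3 : Multiset.map (eigVec X) Finset.univ.val =
      Multiset.map (sortDesc q) Finset.univ.val := by
    have := congrArg Polynomial.roots (h1.symm.trans h2)
    rw [Polynomial.roots_prod _ _ (by simp [Finset.prod_ne_zero_iff, Polynomial.X_sub_C_ne_zero]),
      Polynomial.roots_prod _ _
        (by simp [Finset.prod_ne_zero_iff, Polynomial.X_sub_C_ne_zero])] at this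
    simpa using this.symm
  rw [Fin.univ_val_map, Fin.univ_val_map, Multiset.coe_eq_coe] at h3
  refine List.ofFn_injective (h3.eq_of_sortedGE ?_ ?_)
  · exact (eigVec_antitone hX).sortedGE_ofFn
  · exact (sortDesc_antitone q).sortedGE_ofFn

theorem eigVec_eq_of_charpoly_eq {Y : Matrix (Fin n) (Fin n) ℝ} (hX : X.IsHermitian)
    (hY : Y.IsHermitian) (h : X.charpoly = Y.charpoly) : eigVec X = eigVec Y := by
  rw [eigVec_eq_sortDesc_of_charpoly hX (h.trans (charpoly_eq_prod_eigVec hY)),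
    sortDesc_eq_self (eigVec_antitone hY)]

theorem exists_orthogonal_diagonalization (hX : X.IsHermitian) :
    ∃ V : Matrix (Fin n) (Fin n) ℝ, Vᵀ * V = 1 ∧ Vᵀ * X * V = diagonal (eigVec X) := by
  obtain ⟨σ, hσ⟩ := exists_perm_eigenvalues_eq hX
  set U : Matrix (Fin n) (Fin n) ℝ := hX.eigenvectorUnitary.1 with hU
  have hUU : Uᵀ * U = 1 := by
    have := Unitary.coe_star_mul_self hX.eigenvectorUnitary
    simpa [star_eq_conjTranspose] using this
  have hUX : Uᵀ * X * U = diagonal hX.eigenvalues := by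
    have := hX.conjStarAlgAut_star_eigenvectorUnitary
    rw [Unitary.conjStarAlgAut_star_apply] at this
    simpa [star_eq_conjTranspose, Function.comp_def] using this
  refine ⟨U.submatrix id σ.symm, ?_, ?_⟩
  · rw [← submatrix_one_equiv σ.symm, ← hUU]
    ext i j; simp [mul_apply]
  · rw [transpose_submatrix]
    have h1 : Uᵀ.submatrix σ.symm id * X = (Uᵀ * X).submatrix σ.symm id := by
      ext i j; simp [mul_apply]
    have h2 : (Uᵀ * X).submatrix σ.symm id * U.submatrix id σ.symm =
        (Uᵀ * X * U).submatrix σ.symm σ.symm := by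
      ext i j; simp [mul_apply]
    rw [h1, h2, hUX, submatrix_diagonal_equiv]
    congr 1
    funext i
    simp [hσ]

/-- Bounded weights of total mass `ℓ` against a nonincreasing vector. -/
theorem sum_mul_le_sum_prefix {lam p : Fin n → ℝ} (hl : Antitone lam) {ℓ : ℕ} (hℓ : ℓ ≤ n)
    (hp0 : ∀ i, 0 ≤ p i) (hp1 : ∀ i, p i ≤ 1) (hp : ∑ i, p i = ℓ) :
    ∑ i, lam i * p i ≤ ∑ i with (i : Fin n).val < ℓ, lam i := by
  rcases Nat.eq_zero_or_pos ℓ with rfl | h0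
  · have : ∀ i, p i = 0 := fun i =>
      (Finset.sum_eq_zero_iff_of_nonneg fun i _ => hp0 i).1 (by simpa using hp) i
        (Finset.mem_univ i)
    simp [this]
  set L := lam ⟨ℓ - 1, by omega⟩ with hL
  have key : ∀ i : Fin n, lam i * p i - (if i.val < ℓ then lam i else 0) ≤
      L * (p i - if i.val < ℓ then 1 else 0) := by
    intro i
    split_ifs with h
    · have : L ≤ lam i := hl (Fin.le_def.2 (by simp; omega))
      nlinarith [hp1 i]
    · have : lam i ≤ L := hl (Fin.le_def.2 (by simp; omega))
      nlinarith [hp0 i]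
  have h4 := Finset.sum_le_sum fun i (_ : i ∈ Finset.univ) => key i
  rw [← Finset.mul_sum, Finset.sum_sub_distrib, Finset.sum_sub_distrib, ← Finset.sum_filter,
    ← Finset.sum_filter, hp, Finset.sum_const, Fin.card_filter_val_lt, min_eq_right hℓ] at h4
  simp only [nsmul_eq_mul, mul_one, sub_self, mul_zero] at h4
  linarith

/-- Ky Fan's maximum principle. -/
theorem sum_prefix_diag_le (hX : X.IsHermitian) {V : Matrix (Fin n) (Fin n) ℝ} (hV : Vᵀ * V = 1)
    (ℓ : ℕ) : ∑ i with (i : Fin n).val < ℓ, (Vᵀ * X * V) i i ≤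
      ∑ i with (i : Fin n).val < ℓ, eigVec X i := by
  wlog hℓ : ℓ ≤ n generalizing ℓ
  · have := this n le_rfl
    rw [Finset.filter_true_of_mem fun i _ => i.is_lt] at this
    rwa [Finset.filter_true_of_mem fun i _ => i.is_lt.trans (not_le.1 hℓ)]
  obtain ⟨W, hW, hWX⟩ := exists_orthogonal_diagonalization hX
  have hW' : W * Wᵀ = 1 := mul_eq_one_comm.1 hW
  have hV' : V * Vᵀ = 1 := mul_eq_one_comm.1 hV
  set Q := Wᵀ * V with hQ
  have hQ1 : Qᵀ * Q = 1 := by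
    rw [hQ, transpose_mul, transpose_transpose, Matrix.mul_assoc, ← Matrix.mul_assoc W, hW',
      Matrix.one_mul, hV]
  have hQ2 : Q * Qᵀ = 1 := mul_eq_one_comm.1 hQ1
  have hVX : Vᵀ * X * V = Qᵀ * diagonal (eigVec X) * Q := by
    rw [← hWX, hQ, transpose_mul, transpose_transpose]
    calc Vᵀ * X * V = Vᵀ * ((W * Wᵀ) * X * (W * Wᵀ)) * V := by rw [hW']; simp
      _ = _ := by simp only [Matrix.mul_assoc]
  have hent : ∀ j, (Vᵀ * X * V) j j = ∑ i, eigVec X i * Q i j ^ 2 := by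
    intro j
    rw [hVX, mul_apply]
    refine Finset.sum_congr rfl fun i _ => ?_
    rw [mul_diagonal, transpose_apply]; ring
  have hcol : ∀ j, ∑ i, Q i j ^ 2 = 1 := by
    intro j
    have := congrFun (congrFun hQ1 j) j
    rw [mul_apply, one_apply_eq] at this
    rw [← this]
    exact Finset.sum_congr rfl fun i _ => by rw [transpose_apply]; ring
  have hrow : ∀ i, ∑ j, Q i j ^ 2 = 1 := by
    intro i
    have := congrFun (congrFun hQ2 i) i
    rw [mul_apply, one_apply_eq] at this
    rw [← this]
    exact Finset.sum_congr rfl fun j _ => by rw [transpose_apply]; ring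
  -- The squares of the entries of `Q` are doubly stochastic, so the first `ℓ` columns give weights
  -- in `[0,1]` of total mass `ℓ`.
  calc ∑ i with (i : Fin n).val < ℓ, (Vᵀ * X * V) i i
      = ∑ i, eigVec X i * ∑ j with (j : Fin n).val < ℓ, Q i j ^ 2 := by
        simp_rw [hent, Finset.mul_sum]
        rw [Finset.sum_comm]
    _ ≤ _ := by
        refine sum_mul_le_sum_prefix (eigVec_antitone hX) hℓ
          (fun i => Finset.sum_nonneg fun j _ => sq_nonneg _) (fun i => ?_) ?_
        · rw [← hrow i]
          exact Finset.sum_le_sum_of_subset_of_nonneg (Finset.filter_subset _ _)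
            fun j _ _ => sq_nonneg _
        · rw [Finset.sum_comm]
          simp [hcol, Fin.card_filter_val_lt, hℓ]

theorem sum_diag_conj {V : Matrix (Fin n) (Fin n) ℝ} (hV : Vᵀ * V = 1)
    (X : Matrix (Fin n) (Fin n) ℝ) : ∑ i, (Vᵀ * X * V) i i = X.trace := by
  change (Vᵀ * X * V).trace = _
  rw [trace_mul_cycle, mul_eq_one_comm.1 hV, Matrix.one_mul]

/-! ### Perturbed eigenvalue vectors -/

theorem pertEig_antitone (s : ℕ) {t : ℝ} (ht : 0 ≤ t) (hX : X.IsHermitian) :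
    Antitone (pertEig s t X) := by
  intro i j hij
  have h1 := eigVec_antitone hX hij
  have h2 : i.val ≤ j.val := hij
  unfold pertEig
  split_ifs <;> first | omega | linarith

theorem pertEig_nonneg (s : ℕ) {t : ℝ} (ht : 0 ≤ t) (hX : X.PosSemidef) (i : Fin n) :
    0 ≤ pertEig s t X i := by
  have := eigVec_nonneg hX i
  unfold pertEig
  split_ifs <;> linarith

/-- The affine function of `X` whose value is the dual value of the perturbed diagonal of
`Vᵀ X V`. -/
noncomputable def dualAffine (s : ℕ) (t : ℝ) (w : Fin n → ℝ) (V X : Matrix (Fin n) (Fin n) ℝ) : ℝ :=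
  dualValue s w fun i => (Vᵀ * X * V) i i + t * (if i.val < s then 1 else 0)

/-- Ky Fan and the trace: the diagonal in any orthonormal basis has smaller prefix sums than the
eigenvalues and the same total. -/
theorem psi_pertEig_le_dualAffine {s : ℕ} (hs : 1 ≤ s) (hsn : s ≤ n) {t : ℝ} (ht : 0 ≤ t)
    (hX : X.PosSemidef) {w : Fin n → ℝ} (hw0 : ∀ i, 0 < w i) (hw : Monotone w)
    {V : Matrix (Fin n) (Fin n) ℝ} (hV : Vᵀ * V = 1) :
    psi s (pertEig s t X) ≤ (dualAffine s t w V X : EReal) := by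
  refine (psi_le_dualValue hs hsn (pertEig_nonneg s ht hX) hw0 hw).trans
    (EReal.coe_le_coe_iff.2 ?_)
  rw [sortDesc_eq_self (pertEig_antitone s ht hX.1)]
  refine dualValue_le_of_prefix_le hw (fun ℓ => ?_) ?_
  · unfold pertEig
    rw [Finset.sum_add_distrib, Finset.sum_add_distrib]
    gcongr ?_ + _
    exact sum_prefix_diag_le hX.1 hV ℓ
  · unfold pertEig
    rw [Finset.sum_add_distrib, Finset.sum_add_distrib, sum_diag_conj hV, sum_eigVec hX.1]

theorem exists_dualAffine_lt {s : ℕ} (hs : 1 ≤ s) (hsn : s ≤ n) {t : ℝ} (ht : 0 ≤ t)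
    (hX : X.PosSemidef) {r : ℝ} (hr : psi s (pertEig s t X) < r) :
    ∃ (w : Fin n → ℝ) (V : Matrix (Fin n) (Fin n) ℝ), (∀ i, 0 < w i) ∧ Monotone w ∧ Vᵀ * V = 1 ∧
      dualAffine s t w V X < r := by
  obtain ⟨w, hw0, hw, hlt⟩ := exists_dualValue_lt hs hsn (pertEig_nonneg s ht hX) hr
  obtain ⟨V, hV, hVX⟩ := exists_orthogonal_diagonalization hX.1
  refine ⟨w, V, hw0, hw, hV, ?_⟩
  rw [sortDesc_eq_self (pertEig_antitone s ht hX.1)] at hlt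
  unfold dualAffine
  rw [hVX]
  simp only [diagonal_apply_eq]
  exact hlt

theorem dualAffine_combo (s : ℕ) (t : ℝ) (w : Fin n → ℝ) (V X Y : Matrix (Fin n) (Fin n) ℝ)
    {a b : ℝ} (hab : a + b = 1) : dualAffine s t w V (a • X + b • Y) =
      a * dualAffine s t w V X + b * dualAffine s t w V Y := by
  have hb : b = 1 - a := by linarith
  subst hb
  have h : ∀ i, (Vᵀ * (a • X + (1 - a) • Y) * V) i i =
      a * (Vᵀ * X * V) i i + (1 - a) * (Vᵀ * Y * V) i i := by
    intro i
    simp [Matrix.mul_add, Matrix.add_mul]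
  unfold dualAffine dualValue
  simp only [h]
  have : ∑ i, w i * (a * (Vᵀ * X * V) i i + (1 - a) * (Vᵀ * Y * V) i i +
      t * (if i.val < s then 1 else 0)) =
      a * ∑ i, w i * ((Vᵀ * X * V) i i + t * (if i.val < s then 1 else 0)) +
      (1 - a) * ∑ i, w i * ((Vᵀ * Y * V) i i + t * (if i.val < s then 1 else 0)) := by
    rw [Finset.mul_sum, Finset.mul_sum, ← Finset.sum_add_distrib]
    exact Finset.sum_congr rfl fun i _ => by ring
  rw [this]; ring

theorem continuous_dualAffine (s : ℕ) (t : ℝ) (w : Fin n → ℝ) (V : Matrix (Fin n) (Fin n) ℝ) :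
    Continuous (dualAffine s t w V) := by
  unfold dualAffine dualValue
  fun_prop

/-- An infimum of affine functions: a function nearly optimal at the convex combination bounds both
endpoints. -/
theorem eConcaveOn_psi_pertEig {s : ℕ} (hs : 1 ≤ s) (hsn : s ≤ n) {t : ℝ} (ht : 0 ≤ t) :
    EConcaveOn {Y : Matrix (Fin n) (Fin n) ℝ | Y.PosSemidef} fun X => psi s (pertEig s t X) := by
  rintro ⟨X, r⟩ ⟨hX, hr⟩ ⟨Y, q⟩ ⟨hY, hq⟩ a b ha hb hab
  have hXY : (a • X + b • Y).PosSemidef := (hX.smul ha).add (hY.smul hb)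
  refine ⟨hXY, ?_⟩
  by_contra hlt
  obtain ⟨w, V, hw0, hw, hV, h⟩ := exists_dualAffine_lt hs hsn ht hXY (not_le.1 hlt)
  have h1 := hr.trans (psi_pertEig_le_dualAffine hs hsn ht hX hw0 hw hV)
  have h2 := hq.trans (psi_pertEig_le_dualAffine hs hsn ht hY hw0 hw hV)
  rw [EReal.coe_le_coe_iff] at h1 h2
  rw [dualAffine_combo s t w V X Y hab] at h
  simp only [Prod.snd_add, Prod.smul_snd, smul_eq_mul] at h h1 h2
  nlinarith [mul_le_mul_of_nonneg_left h1 ha, mul_le_mul_of_nonneg_left h2 hb]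

end eig

/-! ### Hypersimplices -/

/-- A vector of the hypersimplex lies in every convex set that contains the `0/1` vectors of the
hypersimplex whose support contains a given set of coordinates on which the vector is `1`. -/
theorem mem_of_indicator_mem {ι : Type*} [Fintype ι] [DecidableEq ι] {K : Set (ι → ℝ)}
    (hK : Convex ℝ K) {m : ℕ} {I : Finset ι}
    (hind : ∀ S : Finset ι, S.card = m → I ⊆ S → (fun i => if i ∈ S then (1 : ℝ) else 0) ∈ K)
    {p : ι → ℝ} (h0 : ∀ i, 0 ≤ p i) (h1 : ∀ i, p i ≤ 1) (hsum : ∑ i, p i = m)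
    (hI : ∀ i ∈ I, p i = 1) : p ∈ K := by
  -- Induction on the number of fractional coordinates.
  induction hN : (Finset.univ.filter fun i => 0 < p i ∧ p i < 1).card using
    Nat.strong_induction_on generalizing p with
  | _ N ih =>
  by_cases hfr : ∃ i, 0 < p i ∧ p i < 1
  · obtain ⟨i, hi0, hi1⟩ := hfr
    -- A lone fractional coordinate would make the total non-integral.
    have hj : ∃ j, j ≠ i ∧ 0 < p j ∧ p j < 1 := by
      by_contra hno
      push Not at hno
      have hval : ∀ k ∈ Finset.univ.erase i, p k = if p k = 1 then 1 else 0 := by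
        intro k hk
        split_ifs with h
        · exact h
        · by_contra hne
          have := hno k (Finset.ne_of_mem_erase hk) ((h0 k).lt_of_ne' hne)
          exact h (le_antisymm (h1 k) this)
      rw [← Finset.add_sum_erase _ _ (Finset.mem_univ i), Finset.sum_congr rfl hval,
        Finset.sum_boole] at hsum
      set q := (Finset.filter (fun k => p k = 1) (Finset.univ.erase i)).card
      have e1 : (q : ℝ) < m := by linarith
      have e2 : (m : ℝ) < (q + 1 : ℕ) := by push_cast; linarith
      rw [Nat.cast_lt] at e1 e2
      omega
    obtain ⟨j, hji, hj0, hj1⟩ := hj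
    -- Move mass from `b` to `a` until one of them becomes integral.
    have step : ∀ a b : ι, a ≠ b → 0 < p a → p a < 1 → 0 < p b → p b < 1 →
        (fun k => p k + min (1 - p a) (p b) *
          ((if k = a then 1 else 0) - if k = b then 1 else 0)) ∈ K := by
      intro a b hab ha0 ha1 hb0 hb1
      set δ := min (1 - p a) (p b) with hδ
      have hδa : δ ≤ 1 - p a := min_le_left _ _
      have hδb : δ ≤ p b := min_le_right _ _
      have hδ0 : 0 < δ := lt_min (by linarith) hb0
      set q : ι → ℝ := fun k => p k + δ * ((if k = a then 1 else 0) - if k = b then 1 else 0)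
        with hq
      have hqa : q a = p a + δ := by simp [hq, hab]
      have hqb : q b = p b - δ := by simp [hq, hab.symm]; ring
      have hqo : ∀ k, k ≠ a → k ≠ b → q k = p k := fun k h2 h3 => by simp [hq, h2, h3]
      refine ih _ ?_ (p := q) ?_ ?_ ?_ ?_ rfl
      · rw [← hN]
        refine Finset.card_lt_card ((Finset.ssubset_iff_of_subset ?_).2 ?_)
        · intro k hk
          simp only [Finset.mem_filter, Finset.mem_univ, true_and] at hk ⊢
          by_cases h2 : k = a
          · rw [h2]; exact ⟨ha0, ha1⟩
          by_cases h3 : k = b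
          · rw [h3]; exact ⟨hb0, hb1⟩
          rwa [hqo k h2 h3] at hk
        · rcases min_choice (1 - p a) (p b) with h | h
          · exact ⟨a, by simp [ha0, ha1], by simp [hqa, hδ, h]⟩
          · exact ⟨b, by simp [hb0, hb1], by simp [hqb, hδ, h]⟩
      · intro k
        by_cases h2 : k = a
        · rw [h2, hqa]; linarith
        by_cases h3 : k = b
        · rw [h3, hqb]; linarith
        rw [hqo k h2 h3]; exact h0 k
      · intro k
        by_cases h2 : k = a
        · rw [h2, hqa]; linarith
        by_cases h3 : k = b
        · rw [h3, hqb]; linarith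
        rw [hqo k h2 h3]; exact h1 k
      · simp [hq, Finset.sum_add_distrib, ← Finset.mul_sum, hsum]
      · intro k hk
        have := hI k hk
        rw [hqo k (by rintro rfl; linarith) (by rintro rfl; linarith), this]
    have hp1 := step i j hji.symm hi0 hi1 hj0 hj1
    have hp2 := step j i hji hj0 hj1 hi0 hi1
    set a := min (1 - p i) (p j) with ha
    set b := min (1 - p j) (p i) with hb
    have ha0 : 0 < a := lt_min (by linarith) hj0
    have hb0 : 0 < b := lt_min (by linarith) hi0
    -- These weights cancel the two opposite shifts, of sizes `a` and `b`.
    have := hK hp1 hp2 (a := b / (a + b)) (b := a / (a + b)) (by positivity) (by positivity)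
      (by field_simp; ring)
    convert this using 1
    funext k
    simp only [Pi.add_apply, Pi.smul_apply, smul_eq_mul]
    field_simp
    ring
  · push Not at hfr
    have hval : p = fun i => if i ∈ Finset.univ.filter (fun i => p i = 1) then 1 else 0 := by
      funext i
      simp only [Finset.mem_filter, Finset.mem_univ, true_and]
      split_ifs with h
      · exact h
      · by_contra hne
        exact h (le_antisymm (h1 i) (hfr i ((h0 i).lt_of_ne' hne)))
    rw [hval]
    refine hind _ ?_ fun i hi => by simp [hI i hi]
    have : ((Finset.univ.filter (fun i => p i = 1)).card : ℝ) = m := by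
      rw [← hsum, ← Finset.sum_boole]
      refine Finset.sum_congr rfl fun i _ => ?_
      rw [congrFun hval i]
      simp
    exact_mod_cast this

/-! ### The concave envelope -/

/-- Exchange `T \ I` for `I \ T`, comparing both with the entry at `s - 1`. No subtraction is used,
so it applies to `EReal`. -/
theorem sum_le_sum_prefix_of_antitone {n s : ℕ} (hs : 1 ≤ s) (hsn : s ≤ n) {M : Type*}
    [AddCommMonoid M] [LinearOrder M] [IsOrderedAddMonoid M] {e : Fin n → M} (he : Antitone e)
    {T : Finset (Fin n)} (hT : T.card = s) :
    ∑ i ∈ T, e i ≤ ∑ i with (i : Fin n).val < s, e i := by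
  set I := Finset.univ.filter fun i : Fin n => i.val < s with hI
  have hIc : I.card = s := by rw [hI, Fin.card_filter_val_lt, min_eq_right hsn]
  rw [← Finset.sum_inter_add_sum_sdiff T I, ← Finset.sum_inter_add_sum_sdiff I T,
    Finset.inter_comm I T]
  have hc : (T \ I).card = (I \ T).card := Finset.card_sdiff_comm (hT.trans hIc.symm)
  refine add_le_add le_rfl ?_
  calc ∑ i ∈ T \ I, e i ≤ (T \ I).card • e ⟨s - 1, by omega⟩ := by
        refine Finset.sum_le_card_nsmul _ _ _ fun i hi => he (Fin.le_def.2 ?_)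
        simp [hI] at hi ⊢; omega
    _ = (I \ T).card • e ⟨s - 1, by omega⟩ := by rw [hc]
    _ ≤ ∑ i ∈ I \ T, e i := by
        refine Finset.card_nsmul_le_sum _ _ _ fun i hi => he (Fin.le_def.2 ?_)
        simp [hI] at hi ⊢; omega

theorem posSemidef_conj_diagonal {n : ℕ} (V : Matrix (Fin n) (Fin n) ℝ) {q : Fin n → ℝ}
    (hq : ∀ i, 0 ≤ q i) : (V * diagonal q * Vᵀ).PosSemidef := by
  have := (PosSemidef.diagonal (d := q) hq).mul_mul_conjTranspose_same V
  simpa using this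

theorem eigVec_conj_diagonal {n : ℕ} {V : Matrix (Fin n) (Fin n) ℝ} (hV : Vᵀ * V = 1)
    {q : Fin n → ℝ} (hq : ∀ i, 0 ≤ q i) : eigVec (V * diagonal q * Vᵀ) = sortDesc q := by
  refine eigVec_eq_sortDesc_of_charpoly (posSemidef_conj_diagonal V hq).1 ?_
  rw [charpoly_mul_comm, ← Matrix.mul_assoc, hV, Matrix.one_mul, charpoly_diagonal]

theorem sum_elog_le_Phi {n s : ℕ} (hs : 1 ≤ s) (hsn : s ≤ n) (t : ℝ)
    {V : Matrix (Fin n) (Fin n) ℝ} (hV : Vᵀ * V = 1) {q : Fin n → ℝ} (hq : ∀ i, 0 ≤ q i)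
    {S : Finset (Fin n)} (hS : S.card = s) :
    ∑ i ∈ S, elog (q i + t) ≤ Phi s t (V * diagonal q * Vᵀ) := by
  unfold Phi
  rw [eigVec_conj_diagonal hV hq]
  set σ := Tuple.sort fun i => -q i with hσ
  have h1 : ∑ i ∈ S, elog (q i + t) = ∑ i ∈ S.map σ.symm.toEmbedding, elog (sortDesc q i + t) := by
    rw [Finset.sum_map]
    simp [sortDesc, ← hσ]
  rw [h1]
  exact sum_le_sum_prefix_of_antitone hs hsn
    (fun i j hij => elog_mono (by linarith [sortDesc_antitone q hij])) (by simpa using hS)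

theorem sum_ite_of_prefix_subset {n s k : ℕ} (hk : k ≤ n) {M : Type*} [AddCommMonoid M]
    {S : Finset (Fin n)} (hS : S.card = s)
    (hkS : (Finset.univ.filter fun i : Fin n => i.val < k) ⊆ S) (g : Fin n → M) (C : M) :
    ∑ i ∈ S, (if i.val < k then g i else C) =
      (∑ i with (i : Fin n).val < k, g i) + (s - k) • C := by
  have h1 : S.filter (fun i : Fin n => i.val < k) =
      Finset.univ.filter fun i : Fin n => i.val < k := by
    ext i
    simp only [Finset.mem_filter, Finset.mem_univ, true_and, and_iff_right_iff_imp]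
    exact fun h => hkS (by simpa using h)
  have h2 : (S.filter fun i : Fin n => ¬ i.val < k).card = s - k := by
    have := Finset.card_filter_add_card_filter_not (s := S) (fun i : Fin n => i.val < k)
    rw [h1, Fin.card_filter_val_lt, hS] at this
    omega
  rw [Finset.sum_ite, Finset.sum_const, h1, h2]

/-- In an eigenbasis of `X`, keep the first `k` eigenvalues and write the others as `c * p i`, where
`c` is the tail mean minus `t`. Then `p` lies in the hypersimplex. At a vertex containing the first
`k` coordinates, the other entries are `c` (`s - k` times) or `0`, so `Phi` is at least the `psi`
value; concavity carries this bound to `X`. -/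
theorem psi_pertEig_le_of_eConcaveOn {n s : ℕ} (hs : 1 ≤ s) (hsn : s ≤ n) {t : ℝ} (ht : 0 ≤ t)
    {X : Matrix (Fin n) (Fin n) ℝ} (hX : X.PosSemidef) {g : Matrix (Fin n) (Fin n) ℝ → EReal}
    (hg : EConcaveOn {Y : Matrix (Fin n) (Fin n) ℝ | Y.PosSemidef} g)
    (hle : ∀ Y ∈ {Y : Matrix (Fin n) (Fin n) ℝ | Y.PosSemidef}, Phi s t Y ≤ g Y) :
    psi s (pertEig s t X) ≤ g X := by
  by_contra hlt
  obtain ⟨r, hr1, hr2⟩ := EReal.exists_between_coe_real (not_le.1 hlt)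
  refine hr1.not_ge ?_
  have hy := pertEig_nonneg s ht hX
  have hsort := sortDesc_eq_self (pertEig_antitone s ht hX.1)
  have hk := psiIndex_lt hs hsn hy
  have hmean := sub_mul_psiMean hs hsn hy
  have hlek : ∀ i : Fin n, psiIndex s (pertEig s t X) ≤ i.val →
      pertEig s t X i ≤ psiMean s (pertEig s t X) := fun i hi => by
    have := sortDesc_le_psiMean hs hsn hy hi
    rwa [hsort] at this
  have hpsi : psi s (pertEig s t X) =
      (∑ i with (i : Fin n).val < psiIndex s (pertEig s t X), elog (pertEig s t X i)) +
        (s - psiIndex s (pertEig s t X)) • elog (psiMean s (pertEig s t X)) := by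
    unfold psi; rw [hsort]; rfl
  have htail : tailSum (pertEig s t X) (psiIndex s (pertEig s t X)) =
      ∑ i with psiIndex s (pertEig s t X) ≤ (i : Fin n).val, pertEig s t X i := by
    unfold tailSum; rw [hsort]
  rw [htail] at hmean
  rw [hpsi] at hr2
  set k := psiIndex s (pertEig s t X) with hkdef
  set c := psiMean s (pertEig s t X) - t with hc
  have hlam0 := eigVec_nonneg hX
  have hlamc : ∀ i : Fin n, k ≤ i.val → eigVec X i ≤ c := by
    intro i hi
    have h1 := hlek ⟨k, by omega⟩ le_rfl
    have h2 := eigVec_antitone hX.1 (show (⟨k, by omega⟩ : Fin n) ≤ i from hi)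
    simp only [pertEig, hk, if_true, mul_one] at h1
    linarith
  have hc0 : 0 ≤ c := (hlam0 ⟨k, by omega⟩).trans (hlamc _ le_rfl)
  have hlamsum : ∑ i with k ≤ (i : Fin n).val, eigVec X i = ((s : ℝ) - k) * c := by
    have h1 : ∑ i with k ≤ (i : Fin n).val, (t * if i.val < s then (1 : ℝ) else 0) =
        ((s : ℝ) - k) * t := by
      have h2 := sum_prefix_add_sum_suffix k fun i : Fin n => if i.val < s then (1 : ℝ) else 0
      rw [Finset.sum_boole, Finset.sum_boole, Finset.sum_boole, Finset.filter_filter] at h2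
      have h3 : (Finset.univ.filter fun i : Fin n => i.val < k ∧ i.val < s) =
          Finset.univ.filter fun i : Fin n => i.val < k := by
        ext i; simp; omega
      rw [h3, Fin.card_filter_val_lt, Fin.card_filter_val_lt, min_eq_right hsn,
        min_eq_right (hk.le.trans hsn)] at h2
      rw [← Finset.mul_sum, Finset.sum_boole]
      linear_combination t * h2
    unfold pertEig at hmean
    rw [Finset.sum_add_distrib, h1] at hmean
    change _ * psiMean s (pertEig s t X) = _ at hmean
    rw [hc]
    linear_combination -hmean
  obtain ⟨V, hV, hVX⟩ := exists_orthogonal_diagonalization hX.1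
  have hV' : V * Vᵀ = 1 := mul_eq_one_comm.1 hV
  have hXV : X = V * diagonal (eigVec X) * Vᵀ := by
    rw [← hVX]
    calc X = (V * Vᵀ) * X * (V * Vᵀ) := by rw [hV']; simp
      _ = _ := by simp only [Matrix.mul_assoc]
  let q : (Fin n → ℝ) → Fin n → ℝ := fun p i => if i.val < k then eigVec X i else c * p i
  have hqcombo : ∀ (p p' : Fin n → ℝ) (a b : ℝ), a + b = 1 →
      V * diagonal (q (a • p + b • p')) * Vᵀ =
        a • (V * diagonal (q p) * Vᵀ) + b • (V * diagonal (q p') * Vᵀ) := by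
    intro p p' a b hab
    have : diagonal (q (a • p + b • p')) = a • diagonal (q p) + b • diagonal (q p') := by
      rw [← diagonal_smul, ← diagonal_smul, diagonal_add]
      congr 1
      funext i
      simp only [q, Pi.add_apply, Pi.smul_apply, smul_eq_mul]
      split_ifs
      · linear_combination (-eigVec X i) * hab
      · ring
    rw [this]
    simp [Matrix.mul_add, Matrix.add_mul]
  -- A superlevel set of `g` along an affine slice; convex because the hypograph is.
  let K : Set (Fin n → ℝ) := {p | (V * diagonal (q p) * Vᵀ).PosSemidef ∧
    (r : EReal) ≤ g (V * diagonal (q p) * Vᵀ)}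
  have hK : Convex ℝ K := by
    intro p hp p' hp' a b ha hb hab
    have := hg (x := (V * diagonal (q p) * Vᵀ, r)) ⟨hp.1, hp.2⟩
      (y := (V * diagonal (q p') * Vᵀ, r)) ⟨hp'.1, hp'.2⟩ ha hb hab
    simp only [Prod.smul_mk, Prod.mk_add_mk, Set.mem_ofPred_eq, smul_eq_mul, ← add_mul, hab,
      one_mul] at this
    rwa [← hqcombo p p' a b hab] at this
  obtain ⟨p, hp0, hp1, hpI, hpc, hpsum⟩ : ∃ p : Fin n → ℝ, (∀ i, 0 ≤ p i) ∧ (∀ i, p i ≤ 1) ∧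
      (∀ i : Fin n, i.val < k → p i = 1) ∧ (∀ i : Fin n, k ≤ i.val → c * p i = eigVec X i) ∧
      ∑ i, p i = s := by
    -- If `c = 0` the remaining eigenvalues vanish, and `𝕀_s` serves as `p`.
    rcases hc0.eq_or_lt with h0 | h0
    · refine ⟨fun i => if i.val < s then 1 else 0, fun i => ?_, fun i => ?_, fun i hi => ?_,
        fun i hi => ?_, ?_⟩
      · dsimp only; split_ifs <;> norm_num
      · dsimp only; split_ifs <;> norm_num
      · exact if_pos (by omega)
      · rw [← h0, zero_mul]
        exact le_antisymm (hlam0 i) (h0 ▸ hlamc i hi)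
      · rw [Finset.sum_boole, Fin.card_filter_val_lt, min_eq_right hsn]
    · refine ⟨fun i => if i.val < k then 1 else eigVec X i / c, fun i => ?_, fun i => ?_,
        fun i hi => ?_, fun i hi => ?_, ?_⟩
      · dsimp only; split_ifs
        · norm_num
        · exact div_nonneg (hlam0 i) hc0
      · dsimp only; split_ifs with h
        · norm_num
        · exact (div_le_one h0).2 (hlamc i (not_lt.1 h))
      · exact if_pos hi
      · simp only [if_neg (not_lt.2 hi)]; field_simp
      · rw [← sum_prefix_add_sum_suffix k]
        rw [Finset.sum_congr rfl (g := fun _ => (1 : ℝ))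
          (fun i hi => if_pos (by simpa using hi)), Finset.sum_const, Fin.card_filter_val_lt,
          min_eq_right (hk.le.trans hsn), Finset.sum_congr rfl (g := fun i => eigVec X i / c)
          (fun i hi => if_neg (by simpa using hi)), ← Finset.sum_div, hlamsum,
          mul_div_cancel_right₀ _ h0.ne']
        simp
  have hmem : p ∈ K := by
    refine mem_of_indicator_mem hK (I := Finset.univ.filter fun i : Fin n => i.val < k)
      (fun S hS hIS => ?_) hp0 hp1 hpsum fun i hi => hpI i (by simpa using hi)
    have hq0 : ∀ i, 0 ≤ q (fun i => if i ∈ S then 1 else 0) i := by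
      intro i
      simp only [q]
      split_ifs <;> simp [hlam0, hc0]
    have hpsd := posSemidef_conj_diagonal V hq0
    refine ⟨hpsd, hr2.le.trans (le_trans ?_ ((sum_elog_le_Phi hs hsn t hV hq0 hS).trans
      (hle _ hpsd)))⟩
    rw [← sum_ite_of_prefix_subset (hk.le.trans hsn) hS hIS]
    refine (Finset.sum_congr rfl fun i hi => ?_).le
    simp only [q, if_pos hi]
    split_ifs with h
    · congr 1
      simp [pertEig, h.trans hk]
    · congr 1
      rw [hc]; ring
  have hqp : q p = eigVec X := by
    funext i
    simp only [q]
    split_ifs with h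
    · rfl
    · exact hpc i (not_lt.1 h)
  have := hmem.2
  rwa [hqp, ← hXV] at this

/-- Termwise `log (w u) ≤ w u - 1` on the first `s` entries, with the other terms `w u ≥ 0`; a zero
among those `s` entries makes `Phi` equal to `⊥`. -/
theorem Phi_le_psi_pertEig {n s : ℕ} (hs : 1 ≤ s) (hsn : s ≤ n) {t : ℝ} (ht : 0 ≤ t)
    {X : Matrix (Fin n) (Fin n) ℝ} (hX : X.PosSemidef) :
    Phi s t X ≤ psi s (pertEig s t X) := by
  have hy := pertEig_nonneg s ht hX
  have hsort := sortDesc_eq_self (pertEig_antitone s ht hX.1)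
  by_contra hlt
  obtain ⟨r, hr1, hr2⟩ := EReal.exists_between_coe_real (not_le.1 hlt)
  obtain ⟨w, hw0, hw, hwr⟩ := exists_dualValue_lt hs hsn hy hr1
  rw [hsort] at hwr
  refine hr2.not_ge ?_
  have hphi : Phi s t X = ∑ i with (i : Fin n).val < s, elog (pertEig s t X i) := by
    unfold Phi
    refine Finset.sum_congr rfl fun i hi => ?_
    have : i.val < s := by simpa using hi
    simp [pertEig, this]
  by_cases hpos : ∀ i : Fin n, i.val < s → 0 < pertEig s t X i
  · rw [hphi, sum_elog_of_pos fun i hi => hpos i (by simpa using hi), EReal.coe_le_coe_iff]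
    refine le_trans ?_ hwr.le
    unfold dualValue
    have e4 : ∑ i with (i : Fin n).val < s, (Real.log (pertEig s t X i) + Real.log (w i)) ≤
        ∑ i with (i : Fin n).val < s, (w i * pertEig s t X i - 1) := by
      refine Finset.sum_le_sum fun i hi => ?_
      have := hpos i (by simpa using hi)
      rw [add_comm, ← Real.log_mul (hw0 i).ne' this.ne']
      exact Real.log_le_sub_one_of_pos (mul_pos (hw0 i) this)
    rw [Finset.sum_add_distrib, Finset.sum_sub_distrib, Finset.sum_const, Fin.card_filter_val_lt,
      min_eq_right hsn, nsmul_eq_mul, mul_one] at e4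
    have e5 : ∑ i with (i : Fin n).val < s, w i * pertEig s t X i ≤
        ∑ i, w i * pertEig s t X i :=
      Finset.sum_le_sum_of_subset_of_nonneg (Finset.filter_subset _ _)
        fun i _ _ => mul_nonneg (hw0 i).le (hy i)
    linarith
  · push Not at hpos
    obtain ⟨i, his, hi⟩ := hpos
    rw [hphi, ← Finset.add_sum_erase _ _ (show i ∈ Finset.univ.filter fun i : Fin n => i.val < s
      by simpa using his), le_antisymm hi (hy i), elog_zero, EReal.bot_add]
    exact bot_le

/-- The concave envelope of `Φ_s(·; t)` at a positive semidefinite matrix. -/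
theorem PhiHat_eq_psi {n s : ℕ} (hs : 1 ≤ s) (hsn : s ≤ n) {t : ℝ} (ht : 0 ≤ t)
    {X : Matrix (Fin n) (Fin n) ℝ} (hX : X.PosSemidef) :
    PhiHat s t X = psi s (pertEig s t X) := by
  refine le_antisymm (sInf_le ⟨fun Y => psi s (pertEig s t Y), eConcaveOn_psi_pertEig hs hsn ht,
    fun Y hY => Phi_le_psi_pertEig hs hsn ht hY, rfl⟩) (le_sInf ?_)
  rintro _ ⟨g, hg, hle, rfl⟩
  exact psi_pertEig_le_of_eConcaveOn hs hsn ht hX hg hle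

/-! ### Weighted Gram matrices -/

section gram

variable {n : ℕ} {A C : Matrix (Fin n) (Fin n) ℝ} {x : Fin n → ℝ}

theorem weightedGram_eq (A : Matrix (Fin n) (Fin n) ℝ) (x : Fin n → ℝ) :
    weightedGram A x = A * diagonal x * Aᵀ := by
  ext i j
  rw [weightedGram, Matrix.sum_apply, mul_apply]
  refine Finset.sum_congr rfl fun k _ => ?_
  rw [mul_diagonal]
  simp [vecMulVec_apply]
  ring

theorem weightedGram_posSemidef (hx : ∀ i, 0 ≤ x i) : (weightedGram A x).PosSemidef := by
  rw [weightedGram_eq]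
  exact posSemidef_conj_diagonal A hx

theorem continuous_weightedGram (A : Matrix (Fin n) (Fin n) ℝ) :
    Continuous (weightedGram A) := by
  unfold weightedGram
  fun_prop

theorem diagonal_sqrt_mul_self (hx : ∀ i, 0 ≤ x i) :
    diagonal (fun i => √(x i)) * diagonal (fun i => √(x i)) = diagonal x := by
  rw [diagonal_mul_diagonal]
  congr 1
  funext i
  exact Real.mul_self_sqrt (hx i)

/-- Swap the factors of `(A E)(E Aᵀ)`. The result sees `A` only through `Aᵀ A`, so different `t`
become comparable. -/
theorem eigVec_weightedGram (hx : ∀ i, 0 ≤ x i) :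
    eigVec (weightedGram A x) =
      eigVec (diagonal (fun i => √(x i)) * (Aᵀ * A) * diagonal (fun i => √(x i))) := by
  refine eigVec_eq_of_charpoly_eq (weightedGram_posSemidef hx).1 ?_ ?_
  · change _ᴴ = _
    simp [Matrix.mul_assoc]
  · rw [weightedGram_eq, ← diagonal_sqrt_mul_self hx, ← Matrix.mul_assoc, Matrix.mul_assoc _ _ Aᵀ,
      charpoly_mul_comm]
    simp only [Matrix.mul_assoc]

theorem feasible_nonempty {s : ℕ} (hs : 1 ≤ s) (hsn : s ≤ n) :
    (fun _ => (s : ℝ) / n) ∈ feasible n s := by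
  have hn : (0 : ℝ) < n := by exact_mod_cast hs.trans hsn
  have hsn' : (s : ℝ) ≤ n := by exact_mod_cast hsn
  refine ⟨fun i => ⟨by positivity, (div_le_one hn).2 hsn'⟩, ?_⟩
  simp
  field_simp

theorem isCompact_feasible (n s : ℕ) : IsCompact (feasible n s) := by
  have : feasible n s = Set.Icc 0 1 ∩ {x : Fin n → ℝ | ∑ i, x i = (s : ℝ)} := by
    ext x
    simp [feasible, Pi.le_def, forall_and]
  rw [this]
  exact isCompact_Icc.inter_right
    (isClosed_eq (by fun_prop) continuous_const)

theorem majorizes_pertEig_weightedGram {s : ℕ} {A₁ A₂ : Matrix (Fin n) (Fin n) ℝ}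
    {t₁ t₂ : ℝ} (ht₁ : 0 ≤ t₁) (ht : t₁ ≤ t₂)
    (h₁ : A₁ᵀ * A₁ = C - t₁ • (1 : Matrix (Fin n) (Fin n) ℝ))
    (h₂ : A₂ᵀ * A₂ = C - t₂ • (1 : Matrix (Fin n) (Fin n) ℝ)) (hsn : s ≤ n)
    (hx : x ∈ feasible n s) :
    Majorizes (pertEig s t₂ (weightedGram A₂ x)) (pertEig s t₁ (weightedGram A₁ x)) := by
  have hx0 : ∀ i, 0 ≤ x i := fun i => (hx.1 i).1
  have hpsd₁ := weightedGram_posSemidef (A := A₁) hx0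
  have hpsd₂ := weightedGram_posSemidef (A := A₂) hx0
  have hE := diagonal_sqrt_mul_self hx0
  set E : Matrix (Fin n) (Fin n) ℝ := diagonal fun i => √(x i) with hEdef
  have hN : E * (A₁ᵀ * A₁) * E = E * (A₂ᵀ * A₂) * E + (t₂ - t₁) • diagonal x := by
    rw [h₁, h₂, ← hE]
    simp only [Matrix.mul_sub, Matrix.sub_mul, Matrix.mul_smul, Matrix.smul_mul, Matrix.mul_one,
      sub_smul]
    abel
  have hH₁ : (E * (A₁ᵀ * A₁) * E).IsHermitian := by
    change _ᴴ = _
    simp [hEdef, Matrix.mul_assoc]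
  have hH₂ : (E * (A₂ᵀ * A₂) * E).IsHermitian := by
    change _ᴴ = _
    simp [hEdef, Matrix.mul_assoc]
  have he₁ : eigVec (weightedGram A₁ x) = eigVec (E * (A₁ᵀ * A₁) * E) := eigVec_weightedGram hx0
  have he₂ : eigVec (weightedGram A₂ x) = eigVec (E * (A₂ᵀ * A₂) * E) := eigVec_weightedGram hx0
  constructor
  · intro ℓ _ hℓ
    rw [sortDesc_eq_self (pertEig_antitone s ht₁ hpsd₁.1),
      sortDesc_eq_self (pertEig_antitone s (ht₁.trans ht) hpsd₂.1)]
    unfold pertEig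
    rw [Finset.sum_add_distrib, Finset.sum_add_distrib, ← Finset.mul_sum, ← Finset.mul_sum,
      Finset.sum_boole, Finset.filter_filter, he₁, he₂]
    obtain ⟨V, hV, hVX⟩ := exists_orthogonal_diagonalization hH₁
    have hV' : V * Vᵀ = 1 := mul_eq_one_comm.1 hV
    -- Ky Fan for the matrix at `t₂`, in an eigenbasis of the one at `t₁`.
    have hky := sum_prefix_diag_le hH₂ hV ℓ
    have hsplit : ∑ i with (i : Fin n).val < ℓ, eigVec (E * (A₁ᵀ * A₁) * E) i =
        ∑ i with (i : Fin n).val < ℓ, (Vᵀ * (E * (A₂ᵀ * A₂) * E) * V) i i +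
          (t₂ - t₁) * ∑ i with (i : Fin n).val < ℓ, (Vᵀ * diagonal x * V) i i := by
      rw [Finset.mul_sum, ← Finset.sum_add_distrib]
      refine Finset.sum_congr rfl fun i _ => ?_
      rw [← diagonal_apply_eq (eigVec (E * (A₁ᵀ * A₁) * E)) i, ← hVX, hN]
      simp [Matrix.mul_add, Matrix.add_mul]
    have hent : ∀ j, (Vᵀ * diagonal x * V) j j = ∑ i, x i * V i j ^ 2 := by
      intro j
      rw [mul_apply]
      refine Finset.sum_congr rfl fun i _ => ?_
      rw [mul_diagonal, transpose_apply]; ring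
    have hd0 : ∀ j, 0 ≤ (Vᵀ * diagonal x * V) j j := fun j => by
      rw [hent]
      exact Finset.sum_nonneg fun i _ => mul_nonneg (hx0 i) (sq_nonneg _)
    have hd1 : ∀ j, (Vᵀ * diagonal x * V) j j ≤ 1 := fun j => by
      have h1 := congrFun (congrFun hV j) j
      rw [mul_apply, one_apply_eq] at h1
      rw [hent, ← h1]
      refine Finset.sum_le_sum fun i _ => ?_
      rw [transpose_apply]
      nlinarith [(hx.1 i).2, sq_nonneg (V i j)]
    have hds : ∑ i with (i : Fin n).val < ℓ, (Vᵀ * diagonal x * V) i i ≤ s := by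
      refine (Finset.sum_le_sum_of_subset_of_nonneg (Finset.filter_subset _ _)
        fun i _ _ => hd0 i).trans ?_
      rw [sum_diag_conj hV, trace_diagonal, hx.2]
    have hdℓ : ∑ i with (i : Fin n).val < ℓ, (Vᵀ * diagonal x * V) i i ≤ ℓ := by
      refine (Finset.sum_le_sum fun i _ => hd1 i).trans ?_
      simp [Fin.card_filter_val_lt]
    have hcard : (Finset.univ.filter fun i : Fin n => i.val < ℓ ∧ i.val < s) =
        Finset.univ.filter fun i : Fin n => i.val < min ℓ s := by
      ext i; simp
    rw [hcard, Fin.card_filter_val_lt, min_eq_right (by omega), hsplit, Nat.cast_min]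
    have := mul_le_mul_of_nonneg_left (le_min hdℓ hds) (sub_nonneg.2 ht)
    linarith
  · unfold pertEig
    rw [Finset.sum_add_distrib, Finset.sum_add_distrib, ← Finset.mul_sum, ← Finset.mul_sum,
      Finset.sum_boole, he₁, he₂, sum_eigVec hH₁, sum_eigVec hH₂, hN, trace_add, trace_smul,
      trace_diagonal, hx.2, Fin.card_filter_val_lt, min_eq_right hsn, smul_eq_mul]
    ring

/-! ### The objective: closed form, semicontinuity, finiteness -/

theorem objective_eq_psi {s : ℕ} (hs : 1 ≤ s) (hsn : s ≤ n) {t : ℝ} (ht : 0 ≤ t)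
    (A : Matrix (Fin n) (Fin n) ℝ) (hx : x ∈ feasible n s) :
    objective s t A x = psi s (pertEig s t (weightedGram A x)) :=
  PhiHat_eq_psi hs hsn ht (weightedGram_posSemidef fun i => (hx.1 i).1)

/-- One continuous dual function, below `z` at `x`, dominates the objective throughout the feasible
set. -/
theorem upperSemicontinuousOn_objective {s : ℕ} (hs : 1 ≤ s) (hsn : s ≤ n) {t : ℝ} (ht : 0 ≤ t)
    (A : Matrix (Fin n) (Fin n) ℝ) : UpperSemicontinuousOn (objective s t A) (feasible n s) := by
  intro x hx z hz
  rw [objective_eq_psi hs hsn ht A hx] at hz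
  obtain ⟨r, hr1, hr2⟩ := EReal.exists_between_coe_real hz
  obtain ⟨w, V, hw0, hw, hV, h⟩ :=
    exists_dualAffine_lt hs hsn ht (weightedGram_posSemidef fun i => (hx.1 i).1) hr1
  have hcont : Continuous fun x' => dualAffine s t w V (weightedGram A x') :=
    (continuous_dualAffine s t w V).comp (continuous_weightedGram A)
  filter_upwards [mem_nhdsWithin_of_mem_nhds (hcont.continuousAt.eventually_lt_const h),
    self_mem_nhdsWithin] with x' hx' hx'f
  rw [objective_eq_psi hs hsn ht A hx'f]
  refine (psi_pertEig_le_dualAffine hs hsn ht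
    (weightedGram_posSemidef fun i => (hx'f.1 i).1) hw0 hw hV).trans_lt (lt_trans ?_ hr2)
  exact EReal.coe_lt_coe_iff.2 hx'

theorem weightedGram_posDef (hA : IsUnit A.det) (hx : ∀ i, 0 < x i) :
    (weightedGram A x).PosDef := by
  rw [weightedGram_eq]
  have := (PosDef.diagonal (d := x) hx).mul_mul_conjTranspose_same (B := A)
    (Matrix.vecMul_injective_of_isUnit ((Matrix.isUnit_iff_isUnit_det A).2 hA))
  simpa using this

theorem isUnit_det_of_transpose_mul_self (hC : C.PosDef) (h : Aᵀ * A = C) : IsUnit A.det := by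
  have h1 := hC.det_pos
  rw [← h, det_mul, det_transpose] at h1
  exact isUnit_iff_ne_zero.2 fun h0 => by simp [h0] at h1

/-- The first `s` perturbed eigenvalues are positive: by the shift if `t > 0`, by invertibility of
`A` if `t = 0`. -/
theorem objective_uniform_ne_bot {s : ℕ} (hC : C.PosDef) (hs : 1 ≤ s) (hsn : s ≤ n) {t : ℝ}
    (ht : 0 ≤ t) (hA : Aᵀ * A = C - t • (1 : Matrix (Fin n) (Fin n) ℝ)) :
    objective s t A (fun _ => (s : ℝ) / n) ≠ ⊥ := by
  have hx := feasible_nonempty hs hsn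
  have hpsd := weightedGram_posSemidef (A := A) fun i => (hx.1 i).1
  rw [objective_eq_psi hs hsn ht A hx]
  refine psi_ne_bot hs hsn (pertEig_nonneg s ht hpsd) fun i hi => ?_
  rw [sortDesc_eq_self (pertEig_antitone s ht hpsd.1)]
  simp only [pertEig, hi, if_true, mul_one]
  rcases ht.eq_or_lt with rfl | h0
  · have hs0 : (0 : ℝ) < s := by exact_mod_cast hs
    have hn0 : (0 : ℝ) < n := by exact_mod_cast hs.trans hsn
    have := eigVec_pos (weightedGram_posDef
      (isUnit_det_of_transpose_mul_self hC (by simpa using hA))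
      fun _ : Fin n => div_pos hs0 hn0) i
    linarith
  · have := eigVec_nonneg hpsd i
    linarith

end gram

/-! ### The main theorem -/

theorem theorem1 {n : ℕ} (C : Matrix (Fin n) (Fin n) ℝ) (hC : C.PosDef)
    (s : ℕ) (hs : 1 ≤ s) (hsn : s ≤ n)
    (A : ℝ → Matrix (Fin n) (Fin n) ℝ)
    (hA : ∀ t ∈ Set.Icc 0 (lamMin C), (A t)ᵀ * A t = C - t • (1 : Matrix (Fin n) (Fin n) ℝ)) :
    -- the supremum defining the bound is a finite maximum
    (∀ t ∈ Set.Icc 0 (lamMin C),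
      (∃ z : ℝ, zHat s t (A t) = z) ∧
      IsGreatest (objective s t (A t) '' feasible n s) (zHat s t (A t))) ∧
    -- the bound is nonincreasing
    AntitoneOn (fun t => zHat s t (A t)) (Set.Icc 0 (lamMin C)) ∧
    -- majorization of the perturbed eigenvalue vectors
    (∀ t₁ t₂ : ℝ, 0 ≤ t₁ → t₁ ≤ t₂ → t₂ ≤ lamMin C → ∀ x ∈ feasible n s,
      Majorizes (pertEig s t₂ (weightedGram (A t₂) x))
        (pertEig s t₁ (weightedGram (A t₁) x))) ∧
    -- Schur-concavity, and the objective in terms of the perturbed eigenvalue vector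
    SchurConcaveOn {y : Fin n → ℝ | ∀ i, 0 ≤ y i} (psi s) ∧
    (∀ t ∈ Set.Icc 0 (lamMin C), ∀ x ∈ feasible n s,
      objective s t (A t) x = psi s (pertEig s t (weightedGram (A t) x))) ∧
    -- the objective does not increase at any feasible point
    (∀ t₁ t₂ : ℝ, 0 ≤ t₁ → t₁ ≤ t₂ → t₂ ≤ lamMin C → ∀ x ∈ feasible n s,
      objective s t₂ (A t₂) x ≤ objective s t₁ (A t₁) x) := by
  have hmaj : ∀ t₁ t₂ : ℝ, 0 ≤ t₁ → t₁ ≤ t₂ → t₂ ≤ lamMin C → ∀ x ∈ feasible n s,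
      Majorizes (pertEig s t₂ (weightedGram (A t₂) x))
        (pertEig s t₁ (weightedGram (A t₁) x)) := fun t₁ t₂ h0 h12 h2 x hx =>
    majorizes_pertEig_weightedGram h0 h12 (hA t₁ ⟨h0, h12.trans h2⟩) (hA t₂ ⟨h0.trans h12, h2⟩)
      hsn hx
  have hobj : ∀ t₁ t₂ : ℝ, 0 ≤ t₁ → t₁ ≤ t₂ → t₂ ≤ lamMin C → ∀ x ∈ feasible n s,
      objective s t₂ (A t₂) x ≤ objective s t₁ (A t₁) x := by
    intro t₁ t₂ h0 h12 h2 x hx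
    have hx0 : ∀ i, 0 ≤ x i := fun i => (hx.1 i).1
    rw [objective_eq_psi hs hsn h0 _ hx, objective_eq_psi hs hsn (h0.trans h12) _ hx]
    exact psi_schurConcaveOn hs hsn _ (pertEig_nonneg s h0 (weightedGram_posSemidef hx0)) _
      (pertEig_nonneg s (h0.trans h12) (weightedGram_posSemidef hx0)) (hmaj t₁ t₂ h0 h12 h2 x hx)
  refine ⟨fun t ht => ?_, ?_, hmaj, psi_schurConcaveOn hs hsn,
    fun t ht x hx => objective_eq_psi hs hsn ht.1 _ hx, hobj⟩
  · obtain ⟨x, hx, hmax⟩ := (upperSemicontinuousOn_objective hs hsn ht.1 (A t)).exists_isMaxOn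
      ⟨_, feasible_nonempty hs hsn⟩ (isCompact_feasible n s)
    have hgreat : IsGreatest (objective s t (A t) '' feasible n s) (objective s t (A t) x) :=
      ⟨mem_image_of_mem _ hx, forall_mem_image.2 hmax⟩
    have hz : zHat s t (A t) = objective s t (A t) x := hgreat.isLUB.sSup_eq
    rw [hz]
    refine ⟨⟨(objective s t (A t) x).toReal, (EReal.coe_toReal ?_ ?_).symm⟩, hgreat⟩
    · rw [objective_eq_psi hs hsn ht.1 _ hx]
      exact psi_ne_top hs hsn (pertEig_nonneg s ht.1
        (weightedGram_posSemidef fun i => (hx.1 i).1))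
    · exact fun hbot => objective_uniform_ne_bot hC hs hsn ht.1 (hA t ht)
        (le_bot_iff.1 (hbot ▸ hmax (feasible_nonempty hs hsn)))
  · intro t₁ h₁ t₂ h₂ h12
    refine sSup_le (forall_mem_image.2 fun x hx => ?_)
    exact (hobj t₁ t₂ h₁.1 h12 h₂.2 x hx).trans (le_sSup (mem_image_of_mem _ hx))
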